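/- Let $2\le m\le n$, let $V\subset(0,\infty)$ be nonempty, let $\varepsilon>0$, and let $\rho\subset(0,\infty)$ be a set of admissible radii that is comeager in $(0,\varepsilon)$. A coloring $f\colon\mathbb{R}^n\to C$ with a nonempty set of colors $C\subset\mathbb{R}$ is said to satisfy $Q^*$ if (1) there are a color $c\in C$ and a nonempty open set $U\subset\mathbb{R}^n$ such that $f^{-1}(c)\cap U$ is comeager in $U$, and (2) for every color $c\in C$, every $p\in\mathbb{R}^n$ and every $r\in\rho$: if $f^{-1}(c)$ contains all the vertices of an $m$-simplex inscribed in the sphere of radius $r$ centered at $p$ (that is, with all its vertices on that sphere) whose $m$-dimensional volume belongs to $V$, then $f(p)=c$. Then the following are equivalent: (i) for every nonempty color set $C\subset\mathbb{R}$, every coloring $f\colon\mathbb{R}^n\to C$ satisfying $Q^*$ is constant; (ii) $\inf V=0$. Moreover, for each fixed infinite color set $C\subset\mathbb{R}$ (for example $C=\mathbb{N}$), every coloring $f\colon\mathbb{R}^n\to C$ satisfying $Q^*$ is constant if and only if $\inf V=0$. -/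

import Mathlib

open Set MeasureTheory

noncomputable section

namespace SphereForcing

/-- The Euclidean space `ℝⁿ`. -/
abbrev E (n : ℕ) : Type := EuclideanSpace ℝ (Fin n)

/-- `A` is comeager in `U`: the trace of `A` on `U` has a meager complement, in the topology
induced on `U`. -/
def ComeagerIn {X : Type*} [TopologicalSpace X] (A U : Set X) : Prop :=
  IsMeagre ((Subtype.val ⁻¹' A : Set U)ᶜ)

/-- `A` is comeager in some nonempty open set. -/
def SomewhereComeager {X : Type*} [TopologicalSpace X] (A : Set X) : Prop :=
  ∃ U : Set X, IsOpen U ∧ U.Nonempty ∧ ComeagerIn A U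

/-- Some color class of `f` is somewhere comeager. -/
def SomewhereComeagerColoring {n : ℕ} {C : Type*} (f : E n → C) : Prop :=
  ∃ c : C, SomewhereComeager (f ⁻¹' {c})

/-- A coloring is monochromatic if it is constant. -/
def Monochromatic {n : ℕ} {C : Type*} (f : E n → C) : Prop :=
  ∀ x y : E n, f x = f y

/-- The forcing condition with property `P`, admissible centers `M` and admissible radii `ρ`:
if the points of color `c` on an admissible sphere include a set with property `P`, then the
center has color `c`. -/
def SatisfiesQ {n : ℕ} {C : Type*} (P : Set (E n) → Prop) (M : Set (E n)) (ρ : Set ℝ)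
    (f : E n → C) : Prop :=
  ∀ c : C, ∀ p ∈ M, ∀ r ∈ ρ,
    (∃ Γ : Set (E n), Γ ⊆ f ⁻¹' {c} ∩ Metric.sphere p r ∧ P Γ) → f p = c

/-- The condition `Q*`: the coloring is somewhere comeager, the set of admissible radii is
comeager in `(0, ε)`, and the forcing condition holds with all points as admissible centers. -/
def SatisfiesQStar {n : ℕ} {C : Type*} (P : Set (E n) → Prop) (ρ : Set ℝ) (ε : ℝ)
    (f : E n → C) : Prop :=
  SomewhereComeagerColoring f ∧ ComeagerIn ρ (Ioo 0 ε) ∧ SatisfiesQ P univ ρ f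

/-- The `m`-volume of an `m`-simplex in `ℝⁿ`: the `m`-dimensional Euclidean Hausdorff measure
(normalized to be Lebesgue measure on `m`-dimensional Euclidean space) of the convex hull of its
vertices. -/
def simplexVol {n m : ℕ} (s : Affine.Simplex ℝ (E n) m) : ℝ :=
  (Measure.euclideanHausdorffMeasure m (convexHull ℝ (range s.points))).toReal

/-- The set `Γ` contains the vertices of an `m`-simplex whose `m`-volume is in `V`. -/
def VolProperty (n m : ℕ) (V : Set ℝ) (Γ : Set (E n)) : Prop :=
  ∃ s : Affine.Simplex ℝ (E n) m, range s.points ⊆ Γ ∧ simplexVol s ∈ V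

end SphereForcing

end

/-!
If `inf V = 0`, a color that is comeager near a point `q` is forced at every point `p` closer than
`ε` to `q`. In polar coordinates around `p`, the Kuratowski-Ulam theorem
(`eventually_residual_of_residual_prod`) yields an admissible radius `r` for which the color is
comeager in a cap of the sphere of radius `r`. That cap contains simplices of all sufficiently small
volumes (`exists_cap_simplex`), in particular one whose volume lies in `V`. Its vertices may miss
the color, but moving it by an isometry `g` that fixes `p` keeps the volume, and each map `g ↦ g u` from
the isometries to the unit sphere is open (`isOpenMap_orbitMap`), so by Baire's theorem a generic
`g` near the identity moves all vertices into the color (`exists_simplex_of_comeagerIn`). Hence the set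
of points near which the color is comeager is clopen, and the color is everywhere
(`monochromatic_of_small_volumes`).

If `inf V > 0`, color the cubes of a fine grid with pairwise different colors. Monochromatic
simplices are then so small that none has its volume in `V`, and the forcing condition is vacuous
(`exists_not_monochromatic`).

Volumes are handled through `simplexVol_eq`: the volume of a simplex is a positive constant times
the square root of the Gram determinant of its edge vectors at one vertex.
-/

namespace SphereForcing

open Filter Topology

/-! ### Sections of comeager sets -/

/-- The sections of a comeager subset of a product are comeager, for comeagerly many base points
(the category analogue of Fubini's theorem, due to Kuratowski and Ulam). -/
theorem eventually_residual_of_residual_prod {X Y : Type*} [TopologicalSpace X]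
    [TopologicalSpace Y] [SecondCountableTopology Y] {D : Set (X × Y)}
    (hD : D ∈ residual (X × Y)) :
    ∀ᶠ x in residual X, ∀ᶠ y in residual Y, (x, y) ∈ D := by
  obtain ⟨S, hSo, hSd, hSc, hSD⟩ := mem_residual_iff.1 hD
  have key : ∀ t ∈ S, ∀ᶠ x in residual X, ∀ᶠ y in residual Y, (x, y) ∈ t := by
    intro t ht
    -- The section at `x` is dense as soon as it meets every member of a countable basis.
    have hB : ∀ W ∈ TopologicalSpace.countableBasis Y,
        ∀ᶠ x in residual X, ∃ y ∈ W, (x, y) ∈ t := by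
      intro W hW
      have hWo := TopologicalSpace.isOpen_of_mem_countableBasis hW
      refine residual_of_dense_open ?_ ?_
      · have : {x | ∃ y ∈ W, (x, y) ∈ t} = Prod.fst '' (t ∩ (univ ×ˢ W)) := by
          ext x; simp [and_comm]
        exact this ▸ isOpenMap_fst _ ((hSo t ht).inter (isOpen_univ.prod hWo))
      · refine dense_iff_inter_open.2 fun O hO hOne => ?_
        obtain ⟨⟨x, y⟩, hxy, hxt⟩ := (hSd t ht).inter_open_nonempty _ (hO.prod hWo)
          (hOne.prod (TopologicalSpace.nonempty_of_mem_countableBasis hW))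
        exact ⟨x, hxy.1, y, hxy.2, hxt⟩
    filter_upwards [(eventually_countable_ball (TopologicalSpace.countable_countableBasis Y)).2 hB]
      with x hx
    have hc : Continuous fun y : Y => (x, y) := by fun_prop
    refine residual_of_dense_open ((hSo t ht).preimage hc) ?_
    refine (TopologicalSpace.isBasis_countableBasis Y).dense_iff.2 fun W hW _ => ?_
    obtain ⟨y, hy, hyt⟩ := hx W hW
    exact ⟨y, hy, hyt⟩
  filter_upwards [(eventually_countable_ball hSc).2 key] with x hx
  filter_upwards [(eventually_countable_ball hSc).2 hx] with y hy
  exact hSD hy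

/-! ### Generic isometries -/

section Rotations

variable {F : Type*} [NormedAddCommGroup F] [InnerProductSpace ℝ F]

/-- The linear isometries of `F` into itself, with the operator norm topology. -/
abbrev Isometries (F : Type*) [NormedAddCommGroup F] [InnerProductSpace ℝ F] : Type _ :=
  {g : F →L[ℝ] F // ∀ x, ‖g x‖ = ‖x‖}

instance [CompleteSpace F] : BaireSpace (Isometries F) := by
  have : IsClosed {g : F →L[ℝ] F | ∀ x, ‖g x‖ = ‖x‖} := by
    simp only [ofPred_forall]
    exact isClosed_iInter fun x => isClosed_eq (by fun_prop) continuous_const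
  have : CompleteSpace (Isometries F) := this.completeSpace_coe
  infer_instance

/-- The reflection in the hyperplane orthogonal to `v`; the identity if `v = 0`. -/
noncomputable def reflect (v : F) : F →L[ℝ] F :=
  ContinuousLinearMap.id ℝ F - (2 / ‖v‖ ^ 2) • (innerSL ℝ v).smulRight v

theorem reflect_apply (v x : F) : reflect v x = (ℝ ∙ v)ᗮ.reflection x := by
  rw [Submodule.reflection_orthogonal_apply, Submodule.reflection_singleton_apply]
  simp [reflect, smul_smul, two_smul]
  module

theorem norm_reflect (v x : F) : ‖reflect v x‖ = ‖x‖ := by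
  rw [reflect_apply, LinearIsometryEquiv.norm_map]

theorem continuousAt_reflect {v : F} (hv : v ≠ 0) : ContinuousAt (reflect : F → F →L[ℝ] F) v := by
  have h : ‖v‖ ^ 2 ≠ 0 := by positivity
  have h1 : Continuous fun v : F => (innerSL ℝ v).smulRight v := by
    have := (ContinuousLinearMap.smulRightL ℝ F F).continuous₂
    exact this.comp ((innerSL ℝ).continuous.prodMk continuous_id)
  have h2 : ContinuousAt (fun v : F => 2 / ‖v‖ ^ 2) v :=
    continuousAt_const.div (by fun_prop) h
  exact continuousAt_const.sub (h2.smul h1.continuousAt)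

/-- The rotation `reflect (a + b) ∘ reflect a` takes `a` to `b` if they have equal norms. This
includes the case `b = -a`, where `reflect (a + b)` is the identity. -/
theorem reflect_reflect {a b : F} (h : ‖a‖ = ‖b‖) : reflect (a + b) (reflect a a) = b := by
  have h1 : reflect a a = -a := by
    rw [reflect_apply, Submodule.reflection_orthogonalComplement_singleton_eq_neg]
  have h2 := Submodule.reflection_sub (v := a) (w := -b) (by simpa using h)
  rw [sub_neg_eq_add] at h2
  rw [h1, map_neg, reflect_apply, h2, neg_neg]

/-- The orbit map of a unit vector. -/
def orbitMap (u : Metric.sphere (0 : F) 1) (g : Isometries F) : Metric.sphere (0 : F) 1 :=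
  ⟨g.1 u, by simp [g.2]⟩

theorem continuous_orbitMap (u : Metric.sphere (0 : F) 1) : Continuous (orbitMap u) := by
  unfold orbitMap; fun_prop

/-- Composing an isometry `g` with the rotation that takes `g u` to a varying unit vector `b` is a
section of the orbit map through `g`, continuous at `b = g u`. -/
theorem isOpenMap_orbitMap (u : Metric.sphere (0 : F) 1) : IsOpenMap (orbitMap u) := by
  refine IsOpenMap.of_sections fun g => ?_
  set a : F := (orbitMap u g : F) with ha
  have hna : ‖a‖ = 1 := by simp [a]
  have ha0 : a ≠ 0 := by rintro h; simp [h] at hna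
  refine ⟨fun b => ⟨(reflect (a + b) ∘L reflect a) ∘L g.1, fun x => ?_⟩, ?_, ?_, fun b => ?_⟩
  · simp [norm_reflect, g.2]
  · refine Topology.IsInducing.subtypeVal.continuousAt_iff.2 ?_
    have h2 : a + (orbitMap u g : F) ≠ 0 := by rw [← ha, ← two_smul ℝ]; simpa using ha0
    have h1 : ContinuousAt (fun b : Metric.sphere (0 : F) 1 => reflect (a + (b : F)))
        (orbitMap u g) :=
      ContinuousAt.comp (f := fun b : Metric.sphere (0 : F) 1 => a + (b : F)) (g := reflect)
        (continuousAt_reflect h2) (by fun_prop)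
    exact (h1.clm_comp continuousAt_const).clm_comp continuousAt_const
  · ext x
    have h2 : reflect (a + a) = reflect a := by
      ext y
      have h3 : (ℝ ∙ (a + a)) = ℝ ∙ a := by
        rw [← two_smul ℝ, Submodule.span_singleton_smul_eq (isUnit_iff_ne_zero.2 two_ne_zero)]
      simp only [reflect_apply, h3]
    change reflect (a + a) (reflect a (g.1 x)) = g.1 x
    rw [h2, reflect_apply, reflect_apply, Submodule.reflection_reflection]
  · ext
    change reflect (a + b) (reflect a a) = b
    exact reflect_reflect (by simp [hna])

end Rotations

/-! ### Polar coordinates -/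

/-- Polar coordinates around `p`, with radii less than `ε`. -/
def polar {F : Type*} [NormedAddCommGroup F] [NormedSpace ℝ F] (p : F) (ε : ℝ)
    (z : Ioo 0 ε × Metric.sphere (0 : F) 1) : F := p + (z.1 : ℝ) • (z.2 : F)

theorem continuous_polar {F : Type*} [NormedAddCommGroup F] [NormedSpace ℝ F] (p : F) (ε : ℝ) :
    Continuous (polar p ε) := by
  unfold polar; fun_prop

theorem isOpenMap_polar {F : Type*} [NormedAddCommGroup F] [NormedSpace ℝ F] (p : F) (ε : ℝ) :
    IsOpenMap (polar p ε) := by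
  have h1 : IsOpenMap (fun x : ({0}ᶜ : Set F) => p + (x : F)) :=
    (isOpenMap_add_left p).comp isOpen_compl_singleton.isOpenMap_subtype_val
  have h2 : IsOpenMap (inclusion (Ioo_subset_Ioi_self : Ioo 0 ε ⊆ Ioi 0)) :=
    isOpen_Ioo.isOpenMap_inclusion _
  have h3 := h1.comp ((homeomorphUnitSphereProd F).symm.isOpenMap.comp
    ((IsOpenMap.id.prodMap h2).comp (Homeomorph.prodComm (Ioo 0 ε) _).isOpenMap))
  convert h3 using 1
  ext z; simp [polar]

/-! ### The volume of a simplex -/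

/-- The volume of the simplex in `ℝᵐ` spanned by the origin and the standard basis vectors. -/
noncomputable def cornerVol (m : ℕ) : ℝ :=
  (volume (convexHull ℝ (insert 0 (range (EuclideanSpace.basisFun (Fin m) ℝ))))).toReal

theorem cornerVol_pos (m : ℕ) : 0 < cornerVol m := by
  set b := EuclideanSpace.basisFun (Fin m) ℝ
  have hb : Bornology.IsBounded (convexHull ℝ (insert 0 (range b))) :=
    isBounded_convexHull.2 (((finite_range b).insert 0).isBounded)
  refine ENNReal.toReal_pos (Measure.measure_pos_of_nonempty_interior _ ?_).ne'
    hb.measure_lt_top.ne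
  rw [interior_convexHull_nonempty_iff_affineSpan_eq_top]
  rw [AffineSubspace.affineSpan_eq_top_iff_vectorSpan_eq_top_of_nonempty _ _ _
    (insert_nonempty _ _), eq_top_iff, ← b.toBasis.span_eq, Submodule.span_le]
  rintro _ ⟨i, rfl⟩
  have := vsub_mem_vectorSpan ℝ (s := insert 0 (range b)) (mem_insert_of_mem _ ⟨i, rfl⟩)
    (mem_insert _ _)
  simpa using this

/-- The Gram determinant of the edges from the first vertex of a (possibly degenerate) simplex. -/
noncomputable def gramDet {n m : ℕ} (q : Fin (m + 1) → E n) : ℝ :=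
  (Matrix.gram ℝ fun i : Fin m => q i.succ - q 0).det

theorem continuous_gramDet {n m : ℕ} : Continuous (gramDet : (Fin (m + 1) → E n) → ℝ) := by
  unfold gramDet
  refine Continuous.matrix_det ?_
  refine continuous_matrix fun i j => ?_
  simp only [Matrix.gram_apply]
  fun_prop

theorem gramDet_nonneg {n m : ℕ} (q : Fin (m + 1) → E n) : 0 ≤ gramDet q :=
  (Matrix.posSemidef_gram ℝ _).det_nonneg

theorem gramDet_ne_zero_iff {n m : ℕ} (q : Fin (m + 1) → E n) :
    gramDet q ≠ 0 ↔ AffineIndependent ℝ q := by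
  rw [gramDet, Matrix.det_gram_ne_zero_iff_linearIndependent,
    affineIndependent_iff_linearIndependent_vsub ℝ q 0,
    ← linearIndependent_equiv (finSuccAboveEquiv (0 : Fin (m + 1)))]
  rfl

theorem gramDet_of_const {n m : ℕ} (hm : m ≠ 0) (x : E n) :
    gramDet (fun _ : Fin (m + 1) => x) = 0 := by
  have : Nonempty (Fin m) := ⟨⟨0, Nat.pos_of_ne_zero hm⟩⟩
  have h : (Matrix.gram ℝ fun _ : Fin m => x - x) = 0 := by ext; simp
  rw [gramDet, h, Matrix.det_zero]

/-- The Gram determinant is invariant under affine isometries. -/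
theorem gramDet_isometry {n m : ℕ} (q : Fin (m + 1) → E n) (p : E n) (r : ℝ)
    (g : Isometries (E n)) :
    gramDet (fun i => p + r • g.1 (q i)) = gramDet (fun i => r • q i) := by
  have h (x y : E n) : inner ℝ (g.1 x) (g.1 y) = inner ℝ x y :=
    (⟨g.1.toLinearMap, g.2⟩ : E n →ₗᵢ[ℝ] E n).inner_map_map x y
  unfold gramDet
  congr 1
  ext i j
  simp only [Matrix.gram_apply, add_sub_add_left_eq_sub, ← smul_sub, ← map_sub, inner_smul_left,
    inner_smul_right, h]

/-- The volume of a simplex is a constant multiple of the square root of its Gram determinant: the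
simplex is an affine image of the standard corner simplex. -/
theorem simplexVol_eq {n m : ℕ} (s : Affine.Simplex ℝ (E n) m) :
    simplexVol s = √(gramDet s.points) * cornerVol m := by
  set b := EuclideanSpace.basisFun (Fin m) ℝ with hb
  let L : E m →ₗ[ℝ] E n := b.toBasis.constr ℝ fun i => s.points i.succ - s.points 0
  have hL (i : Fin m) : L (b i) = s.points i.succ - s.points 0 := by
    rw [← b.coe_toBasis, Module.Basis.constr_basis]
  have himg : convexHull ℝ (range s.points) = (fun x => s.points 0 + x) ''
      (L '' convexHull ℝ (insert 0 (range b))) := by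
    have h1 : range s.points = (AffineEquiv.constVAdd ℝ (E n) (s.points 0)).toAffineMap ''
        (L '' insert 0 (range b)) := by
      rw [image_insert_eq, map_zero, ← range_comp, image_insert_eq, ← range_comp]
      ext x
      simp [hL, Fin.exists_fin_succ, eq_comm]
    rw [h1, ← AffineMap.image_convexHull, ← L.image_convexHull]
    rfl
  have hiso : Isometry (fun x : E n => s.points 0 + x) := isometry_add_left _
  have hvol := L.euclideanHausdorffMeasure_image_eq_normDet_mul_volume
    (convexHull ℝ (insert 0 (range b)))
  rw [finrank_euclideanSpace_fin] at hvol
  rw [simplexVol, himg, hiso.euclideanHausdorffMeasure_image, hvol, ENNReal.toReal_mul,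
    ENNReal.toReal_ofReal L.normDet_nonneg]
  congr 1
  have hsq := L.normDet_sq_eq_det_gram b
  simp only [hL] at hsq
  rw [eq_comm, Real.sqrt_eq_iff_eq_sq (gramDet_nonneg _) L.normDet_nonneg]
  exact hsq.symm

/-! ### Small simplices in spherical caps -/

/-- Every nonempty relatively open part of a sphere in dimension at least two spans the space. -/
theorem vectorSpan_cap {F : Type*} [NormedAddCommGroup F] [InnerProductSpace ℝ F]
    [FiniteDimensional ℝ F] (hF : 2 ≤ Module.finrank ℝ F) {u : F} (hu : ‖u‖ = 1)
    {W : Set F} (hW : W ∈ 𝓝 u) : vectorSpan ℝ (W ∩ Metric.sphere 0 1) = ⊤ := by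
  have huW : u ∈ W ∩ Metric.sphere (0 : F) 1 := ⟨mem_of_mem_nhds hW, by simpa using hu⟩
  rw [← Submodule.orthogonal_eq_bot_iff, Submodule.eq_bot_iff]
  intro a ha
  -- Compare `u` with the two nearby points at angles `±θ` on a great circle through `u`.
  have key (d : F) (hd : ‖d‖ = 1) (hud : inner ℝ u d = 0) : inner ℝ u a = 0 ∧ inner ℝ d a = 0 := by
    have hc : Continuous fun θ : ℝ => Real.cos θ • u + Real.sin θ • d := by fun_prop
    have h0 : ∀ᶠ θ : ℝ in 𝓝 0, Real.cos θ • u + Real.sin θ • d ∈ W :=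
      hc.continuousAt.eventually_mem (by simpa using hW)
    have h0' : ∀ᶠ θ : ℝ in 𝓝 0, Real.cos (-θ) • u + Real.sin (-θ) • d ∈ W :=
      (hc.comp continuous_neg).continuousAt.eventually_mem (by simpa using hW)
    have h1 : ∀ᶠ θ : ℝ in 𝓝[>] 0, θ ∈ Ioo (0 : ℝ) 1 := Ioo_mem_nhdsGT one_pos
    obtain ⟨θ, ⟨hθ0, hθ1⟩, hθ, hθ'⟩ := (h1.and (nhdsWithin_le_nhds (h0.and h0'))).exists
    have hsph (t : ℝ) : Real.cos t • u + Real.sin t • d ∈ Metric.sphere (0 : F) 1 := by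
      rw [mem_sphere_zero_iff_norm, ← sq_eq_sq₀ (norm_nonneg _) one_pos.le, norm_add_sq_real]
      simp [norm_smul, hu, hd, inner_smul_left, inner_smul_right, hud]
    have e1 := ha _ (vsub_mem_vectorSpan ℝ (show _ ∈ W ∩ Metric.sphere (0 : F) 1 from
      ⟨hθ, hsph θ⟩) huW)
    have e2 := ha _ (vsub_mem_vectorSpan ℝ (show _ ∈ W ∩ Metric.sphere (0 : F) 1 from
      ⟨hθ', hsph (-θ)⟩) huW)
    simp only [vsub_eq_sub, inner_sub_left, inner_add_left, inner_smul_left, Real.cos_neg,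
      Real.sin_neg, conj_trivial] at e1 e2
    have hsin : Real.sin θ ≠ 0 :=
      (Real.sin_pos_of_pos_of_lt_pi hθ0 (by linarith [Real.pi_gt_three])).ne'
    have hcos : Real.cos θ - 1 ≠ 0 := by
      intro h
      nlinarith [Real.sin_sq_add_cos_sq θ, sq_pos_of_ne_zero hsin]
    constructor
    · refine (mul_eq_zero.1 (?_ : (Real.cos θ - 1) * inner ℝ u a = 0)).resolve_left hcos
      linarith
    · refine (mul_eq_zero.1 (?_ : Real.sin θ * inner ℝ d a = 0)).resolve_left hsin
      linarith
  have hua : inner ℝ u a = 0 := by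
    obtain ⟨d, hd0, hd⟩ : ∃ d : F, d ≠ 0 ∧ inner ℝ u d = 0 := by
      have : (ℝ ∙ u)ᗮ ≠ ⊥ := by
        rw [Ne, Submodule.orthogonal_eq_bot_iff]
        intro h
        have h1 := finrank_span_singleton (K := ℝ) (show u ≠ 0 by rintro rfl; simp at hu)
        rw [h, finrank_top] at h1
        omega
      obtain ⟨d, hd, hd0⟩ := Submodule.exists_mem_ne_zero_of_ne_bot this
      exact ⟨d, hd0, Submodule.mem_orthogonal_singleton_iff_inner_right.1 hd⟩
    exact (key (‖d‖⁻¹ • d) (norm_smul_inv_norm hd0) (by rw [inner_smul_right, hd, mul_zero])).1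
  by_contra ha0
  have := (key (‖a‖⁻¹ • a) (norm_smul_inv_norm ha0) (by rw [inner_smul_right, hua, mul_zero])).2
  rw [inner_smul_left, real_inner_self_eq_norm_sq] at this
  have : ‖a‖ ≠ 0 := by simpa using ha0
  simp_all

/-- In every cap of the unit sphere there are `m + 1` affinely independent points. -/
theorem exists_affineIndependent_cap {n m : ℕ} (hm : 2 ≤ m) (hmn : m ≤ n) {u : E n} (hu : ‖u‖ = 1)
    {W : Set (E n)} (hW : W ∈ 𝓝 u) :
    ∃ q : Fin (m + 1) → E n, (∀ i, q i ∈ W ∧ ‖q i‖ = 1) ∧ AffineIndependent ℝ q := by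
  obtain ⟨t, hts, hspan, ht⟩ := exists_affineIndependent ℝ (E n) (W ∩ Metric.sphere (0 : E n) 1)
  have hv := vectorSpan_cap (F := E n) (by simp; omega) hu hW
  have hfin : Finite t := finite_of_fin_dim_affineIndependent ℝ ht
  have hfin' := Fintype.ofFinite t
  have hcard : m + 1 ≤ Fintype.card t := by
    have h1 := finrank_vectorSpan_range_le ℝ ((↑) : t → E n) (n := Fintype.card t - 1)
    have hne : t.Nonempty := by
      rw [← affineSpan_nonempty ℝ, hspan, affineSpan_nonempty]
      exact ⟨u, mem_of_mem_nhds hW, by simpa using hu⟩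
    have hpos : 0 < Fintype.card t := Fintype.card_pos_iff.2 hne.to_subtype
    have h2 := h1 (Nat.sub_add_cancel hpos).symm
    rw [Subtype.range_coe, ← direction_affineSpan, hspan, direction_affineSpan, hv, finrank_top,
      finrank_euclideanSpace_fin] at h2
    omega
  obtain ⟨e⟩ : Nonempty (Fin (m + 1) ↪ t) :=
    Function.Embedding.nonempty_of_card_le (by simpa using hcard)
  refine ⟨fun i => e i, fun i => ⟨(hts (e i).2).1, by simpa using (hts (e i).2).2⟩, ?_⟩
  exact ht.comp_embedding e

/-- Every cap contains simplices of all sufficiently small volumes: shrink an affinely independent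
family radially to the centre of the cap, and apply the intermediate value theorem. -/
theorem exists_cap_simplex {n m : ℕ} (hm : 2 ≤ m) (hmn : m ≤ n) (u : Metric.sphere (0 : E n) 1)
    {W : Set (Metric.sphere (0 : E n) 1)} (hW : W ∈ 𝓝 u) {r : ℝ} (hr : r ≠ 0) :
    ∃ δ > 0, ∀ v, 0 < v → v < δ → ∃ w : Fin (m + 1) → Metric.sphere (0 : E n) 1,
      (∀ i, w i ∈ W) ∧ √(gramDet fun i => r • (w i : E n)) * cornerVol m = v := by
  have hu : ‖(u : E n)‖ = 1 := by simp
  obtain ⟨W', hW', hWW'⟩ := mem_nhds_induced _ _ _ |>.1 hW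
  let y (q : E n) (t : ℝ) : E n := (1 - t) • (u : E n) + t • q
  have hev : ∀ᶠ q in 𝓝 (u : E n), ∀ t ∈ Icc (0 : ℝ) 1, y q t ≠ 0 ∧ ‖y q t‖⁻¹ • y q t ∈ W' := by
    refine isCompact_Icc.eventually_forall_of_forall_eventually fun t _ => ?_
    have hy : y u t = u := by simp only [y]; module
    have hy0 : y u t ≠ 0 := by rw [hy]; intro h; simp [h] at hu
    have hc : Continuous fun z : E n × ℝ => y z.1 z.2 := by fun_prop
    have hc2 : ContinuousAt (fun z : E n × ℝ => ‖y z.1 z.2‖⁻¹ • y z.1 z.2) ((u : E n), t) :=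
      (hc.norm.continuousAt.inv₀ (by simpa using hy0)).smul hc.continuousAt
    exact (hc.continuousAt.eventually_ne hy0).and
      (hc2.eventually_mem (by simpa [hy, hu] using hW'))
  obtain ⟨q, hq, hqi⟩ := exists_affineIndependent_cap hm hmn hu hev
  let z (t : ℝ) (i : Fin (m + 1)) : E n := ‖y (q i) t‖⁻¹ • y (q i) t
  let vol (t : ℝ) : ℝ := √(gramDet fun i => r • z t i) * cornerVol m
  have hz : ContinuousOn z (Icc 0 1) := by
    refine continuousOn_pi.2 fun i => ?_
    have hc : Continuous fun t : ℝ => y (q i) t := by fun_prop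
    exact (hc.norm.continuousOn.inv₀ fun t ht => by simpa using ((hq i).1 t ht).1).smul
      hc.continuousOn
  have hvol : ContinuousOn vol (Icc 0 1) := by
    refine ((continuous_gramDet.comp_continuousOn ?_).sqrt).mul continuousOn_const
    exact continuousOn_pi.2 fun i => (continuousOn_pi.1 hz i).const_smul r
  have hvol0 : vol 0 = 0 := by
    simp only [vol, z, y, sub_zero, one_smul, zero_smul, add_zero]
    rw [gramDet_of_const (by omega)]
    simp
  have hvol1 : 0 < vol 1 := by
    refine mul_pos (Real.sqrt_pos.2 ((gramDet_nonneg _).lt_of_ne' ?_)) (cornerVol_pos m)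
    rw [gramDet_ne_zero_iff]
    have : (fun i => r • z 1 i) = (Units.mk0 r hr) • q := by
      ext1 i
      simp [z, y, (hq i).2, Units.smul_def]
    rw [this]
    exact (affineIndependent_smul ℝ).2 hqi
  refine ⟨vol 1, hvol1, fun v hv0 hv1 => ?_⟩
  obtain ⟨t, ht, rfl⟩ := intermediate_value_Icc zero_le_one hvol
    (show v ∈ Icc (vol 0) (vol 1) from ⟨hvol0.trans_le hv0.le, hv1.le⟩)
  refine ⟨fun i => ⟨z t i, ?_⟩, fun i => hWW' ((hq i).1 t ht).2, rfl⟩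
  rw [mem_sphere_zero_iff_norm]
  exact norm_smul_inv_norm ((hq i).1 t ht).1

/-! ### Propagation of a color -/

/-- If a color class `A` is comeager in an open set `G` at distance less than `ε` from `p`, then an
admissible sphere around `p` has an inscribed simplex with vertices in `A` and volume in `V`. -/
theorem exists_simplex_of_comeagerIn {n m : ℕ} (hm : 2 ≤ m) (hmn : m ≤ n) {V : Set ℝ}
    (hVpos : V ⊆ Ioi 0) (hVsmall : ∀ δ > 0, ∃ v ∈ V, v < δ) {ρ : Set ℝ} {ε : ℝ}
    (hρ : ComeagerIn ρ (Ioo 0 ε)) {A G : Set (E n)} (hG : IsOpen G) (hA : ComeagerIn A G)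
    {p q : E n} (hq : q ∈ G) (hpq : dist q p < ε) :
    ∃ r ∈ ρ, ∃ s : Affine.Simplex ℝ (E n) m,
      range s.points ⊆ A ∩ Metric.sphere p r ∧ simplexVol s ∈ V := by
  have : Nonempty (Fin n) := ⟨⟨0, by omega⟩⟩
  obtain ⟨x, hxp, hx⟩ := (dense_compl_singleton p).inter_open_nonempty
    (Metric.ball p ε ∩ G) (Metric.isOpen_ball.inter hG) ⟨q, hpq, hq⟩ |>.imp fun _ h => h.symm
  have hxp0 : x - p ≠ 0 := sub_ne_zero.2 hxp
  let r₀ : Ioo 0 ε := ⟨‖x - p‖, norm_pos_iff.2 hxp0, by simpa [dist_eq_norm] using hx.1⟩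
  let u : Metric.sphere (0 : E n) 1 := ⟨‖x - p‖⁻¹ • (x - p), by
    rw [mem_sphere_zero_iff_norm]; exact norm_smul_inv_norm hxp0⟩
  have hpolar : polar p ε (r₀, u) = x := by
    have : ‖x - p‖ ≠ 0 := norm_ne_zero_iff.2 hxp0
    simp [polar, r₀, u, smul_smul, this]
  obtain ⟨I, W, hI, hW, hr₀, hu, hIW⟩ := isOpen_prod_iff.1
    (hG.preimage (continuous_polar p ε)) r₀ u (by rw [mem_preimage, hpolar]; exact hx.2)
  have hres : A ∪ Gᶜ ∈ residual (E n) := by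
    have h := IsMeagre.image_val hA
    rw [IsMeagre] at h
    refine mem_of_superset h fun z hz => ?_
    by_contra hzA
    simp only [mem_union, mem_compl_iff, not_or, not_not] at hzA
    exact hz ⟨⟨z, hzA.2⟩, hzA.1, rfl⟩
  have hρ' : ∀ᶠ r : Ioo 0 ε in residual _, (r : ℝ) ∈ ρ := by
    have h := hρ
    rwa [ComeagerIn, IsMeagre, compl_compl] at h
  have hsec := eventually_residual_of_residual_prod
    (tendsto_residual_of_isOpenMap (continuous_polar p ε) (isOpenMap_polar p ε) hres)
  have : BaireSpace (Ioo 0 ε) := isOpen_Ioo.baireSpace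
  obtain ⟨r, hrI, hrρ, hr⟩ := (dense_of_mem_residual (hρ'.and hsec)).inter_open_nonempty I hI
    ⟨r₀, hr₀⟩
  obtain ⟨δ, hδ, hsimplex⟩ := exists_cap_simplex hm hmn u (hW.mem_nhds hu) r.2.1.ne'
  obtain ⟨v, hvV, hvδ⟩ := hVsmall δ hδ
  obtain ⟨w, hwW, hwv⟩ := hsimplex v (hVpos hvV) hvδ
  -- A generic isometry close to the identity moves all the vertices into `A`.
  have hgen : ∀ᶠ g : Isometries (E n) in residual _,
      ∀ i, polar p ε (r, orbitMap (w i) g) ∈ A ∪ Gᶜ :=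
    eventually_countable_forall.2 fun i =>
      tendsto_residual_of_isOpenMap (continuous_orbitMap (w i)) (isOpenMap_orbitMap (w i)) hr
  obtain ⟨g, hgW, hgA⟩ := (dense_of_mem_residual hgen).inter_open_nonempty
    (⋂ i, orbitMap (w i) ⁻¹' W) (isOpen_iInter_of_finite fun i =>
      hW.preimage (continuous_orbitMap (w i)))
    ⟨⟨ContinuousLinearMap.id ℝ _, fun _ => rfl⟩, mem_iInter.2 fun i => hwW i⟩
  have hdet := gramDet_isometry (fun i => (w i : E n)) p r g
  have hpos : 0 < √(gramDet fun i => (r : ℝ) • (w i : E n)) :=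
    pos_of_mul_pos_left (hwv ▸ hVpos hvV : (0 : ℝ) < _) (cornerVol_pos m).le
  refine ⟨r, hrρ, ⟨fun i => p + (r : ℝ) • g.1 (w i), ?_⟩, ?_, ?_⟩
  · rw [← gramDet_ne_zero_iff, hdet]
    exact (Real.sqrt_pos.1 hpos).ne'
  · rintro _ ⟨i, rfl⟩
    constructor
    · exact (hgA i).resolve_right fun h => h (hIW ⟨hrI, mem_iInter.1 hgW i⟩)
    · simp [norm_smul, g.2, abs_of_pos r.2.1]
  · rw [simplexVol_eq, hdet, hwv]
    exact hvV

/-- The points near which a color is comeager form a clopen set: the color propagates from each of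
them to the whole ball of radius `ε`. -/
theorem monochromatic_of_small_volumes {n m : ℕ} (hm : 2 ≤ m) (hmn : m ≤ n) {V : Set ℝ}
    (hVpos : V ⊆ Ioi 0) (hVsmall : ∀ δ > 0, ∃ v ∈ V, v < δ) {ρ : Set ℝ} {ε : ℝ} (hε : 0 < ε)
    {C : Type*} {f : E n → C} (hf : SatisfiesQStar (VolProperty n m V) ρ ε f) :
    Monochromatic f := by
  obtain ⟨⟨c, U, hU, hUne, hUc⟩, hρ, hQ⟩ := hf
  let K : Set (E n) := {x | ∃ G, IsOpen G ∧ x ∈ G ∧ ComeagerIn (f ⁻¹' {c}) G}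
  have hstep {p q : E n} (hq : q ∈ K) (hpq : dist q p < ε) : f p = c := by
    obtain ⟨G, hG, hqG, hGc⟩ := hq
    obtain ⟨r, hr, s, hs, hsV⟩ :=
      exists_simplex_of_comeagerIn hm hmn hVpos hVsmall hρ hG hGc hqG hpq
    exact hQ c p (mem_univ p) r hr ⟨_, hs, s, subset_rfl, hsV⟩
  have hball {q : E n} (hq : q ∈ K) : Metric.ball q ε ⊆ K := fun p hp =>
    ⟨Metric.ball q ε, Metric.isOpen_ball, hp, by
      have : (Subtype.val ⁻¹' (f ⁻¹' {c}) : Set (Metric.ball q ε)) = univ :=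
        eq_univ_of_forall fun z => hstep hq (Metric.mem_ball'.1 z.2)
      rw [ComeagerIn, this, compl_univ]
      exact IsMeagre.empty⟩
  have hK : IsClopen K := by
    refine ⟨isClosed_of_closure_subset fun p hp => ?_,
      Metric.isOpen_iff.2 fun q hq => ⟨ε, hε, hball hq⟩⟩
    obtain ⟨q, hq, hpq⟩ := Metric.mem_closure_iff.1 hp ε hε
    exact hball hq hpq
  have hKuniv : K = univ := hK.eq_univ (hUne.imp fun x hx => ⟨U, hU, hx, hUc⟩)
  have hall (p : E n) : f p = c := hstep (hKuniv ▸ mem_univ p) (by simpa using hε)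
  exact fun x y => (hall x).trans (hall y).symm

/-! ### The grid coloring -/

/-- The integer coordinates of the cube of side `η` that contains a point. -/
noncomputable def cubeIndex {n : ℕ} (η : ℝ) (x : E n) (i : Fin n) : ℤ := ⌊x i / η⌋

theorem simplexVol_le_of_cubeIndex_eq {n m : ℕ} {η : ℝ} (hη : 0 < η)
    (s : Affine.Simplex ℝ (E n) m) (k : Fin n → ℤ) (hs : ∀ i, cubeIndex η (s.points i) = k) :
    simplexVol s ≤ √(m.factorial * (n * η ^ 2) ^ m) * cornerVol m := by
  have hcoord (i j : Fin (m + 1)) (l : Fin n) : |s.points i l - s.points j l| ≤ η := by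
    have h := Int.abs_sub_lt_one_of_floor_eq_floor
      ((congrFun (hs i) l).trans (congrFun (hs j) l).symm)
    rw [← sub_div, abs_div, abs_of_pos hη, div_lt_one hη] at h
    exact h.le
  have hentry (i j : Fin m) : |Matrix.gram ℝ (fun i : Fin m => s.points i.succ - s.points 0) i j|
      ≤ n * η ^ 2 := by
    rw [Matrix.gram_apply, PiLp.inner_apply]
    refine (Finset.abs_sum_le_sum_abs _ _).trans ?_
    refine (Finset.sum_le_sum (g := fun _ => η ^ 2) fun l _ => ?_).trans (by simp)
    simp only [PiLp.sub_apply, RCLike.inner_apply, conj_trivial, abs_mul]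
    rw [sq]
    exact mul_le_mul (hcoord _ _ _) (hcoord _ _ _) (abs_nonneg _) hη.le
  have hdet := Matrix.det_le (abv := AbsoluteValue.abs) hentry
  rw [simplexVol_eq]
  refine mul_le_mul_of_nonneg_right (Real.sqrt_le_sqrt ?_) (cornerVol_pos m).le
  simpa [gramDet] using (le_abs_self _).trans hdet

/-- If the volumes in `V` are bounded away from zero, then coloring the cubes of a fine grid with
pairwise different colors satisfies the forcing condition vacuously. -/
theorem exists_not_monochromatic {n m : ℕ} (hm : m ≠ 0) (hmn : m ≤ n) {V : Set ℝ} {δ : ℝ}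
    (hδ : 0 < δ) (hV : ∀ v ∈ V, δ ≤ v) {ρ : Set ℝ} {ε : ℝ} (hρ : ComeagerIn ρ (Ioo 0 ε))
    (C : Type*) [Infinite C] :
    ∃ f : E n → C, SatisfiesQStar (VolProperty n m V) ρ ε f ∧ ¬ Monochromatic f := by
  obtain ⟨η, hη, hηδ⟩ : ∃ η > 0, √(m.factorial * (n * η ^ 2) ^ m) * cornerVol m < δ := by
    have hc : Continuous fun η : ℝ => √(m.factorial * (n * η ^ 2) ^ m) * cornerVol m := by
      fun_prop
    have h1 : ∀ᶠ η : ℝ in 𝓝[>] 0, √(m.factorial * (n * η ^ 2) ^ m) * cornerVol m < δ :=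
      nhdsWithin_le_nhds (hc.continuousAt.eventually_lt_const (by simpa [hm] using hδ))
    exact (eventually_mem_nhdsWithin.and h1).exists
  obtain ⟨e, he⟩ := Countable.exists_injective_nat (Fin n → ℤ)
  let ι : (Fin n → ℤ) → C := Infinite.natEmbedding C ∘ e
  have hι : Function.Injective ι := (Infinite.natEmbedding C).injective.comp he
  refine ⟨fun x => ι (cubeIndex η x), ⟨⟨ι 0, ?_⟩, hρ, ?_⟩, fun h => ?_⟩
  · refine ⟨⋂ i, {x | 0 < x i ∧ x i < η}, ?_, ?_, ?_⟩
    · refine isOpen_iInter_of_finite fun i => ?_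
      have hc : Continuous fun x : E n => x i := by fun_prop
      exact (isOpen_lt continuous_const hc).inter (isOpen_lt hc continuous_const)
    · exact ⟨WithLp.toLp 2 fun _ => η / 2, mem_iInter.2 fun i => ⟨by simpa, by simpa⟩⟩
    · have : (Subtype.val ⁻¹' ((fun x => ι (cubeIndex η x)) ⁻¹' {ι 0}) :
          Set (⋂ i, {x : E n | 0 < x i ∧ x i < η} : Set (E n))) = univ := by
        refine eq_univ_of_forall fun x => congrArg ι (funext fun i => ?_)
        obtain ⟨h0, h1⟩ := mem_iInter.1 x.2 i
        exact Int.floor_eq_zero_iff.2 ⟨by positivity, (div_lt_one hη).2 h1⟩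
      rw [ComeagerIn, this, compl_univ]
      exact IsMeagre.empty
  · rintro c p - r - ⟨Γ, hΓ, s, hs, hsV⟩
    have hsc (i) : ι (cubeIndex η (s.points i)) = c := (hΓ (hs ⟨i, rfl⟩)).1
    have := simplexVol_le_of_cubeIndex_eq hη s _ fun i => hι ((hsc i).trans (hsc 0).symm)
    exact absurd (hV _ hsV) (this.trans_lt hηδ).not_ge
  · have h1 := congrFun (hι (h 0 (WithLp.toLp 2 fun _ => η))) ⟨0, by omega⟩
    simp [cubeIndex, hη.ne'] at h1

end SphereForcing

/-- For fixed dimensions, volumes and radii: forcing by simplex volumes makes every coloring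
monochromatic iff the infimum of the volumes is `0`. The first equivalence lets the color set `C`
range over all color sets; the second holds for each single infinite color set `C`. -/
theorem theorem7 (n m : ℕ) (hm : 2 ≤ m) (hmn : m ≤ n)
    (V : Set ℝ) (hV : V.Nonempty) (hVpos : V ⊆ Set.Ioi 0)
    (ρ : Set ℝ) (hρpos : ρ ⊆ Set.Ioi 0)
    (ε : ℝ) (hε : 0 < ε) (hρ : SphereForcing.ComeagerIn ρ (Set.Ioo 0 ε)) :
    ((∀ C : Set ℝ, C.Nonempty → ∀ f : SphereForcing.E n → C,
        SphereForcing.SatisfiesQStar (SphereForcing.VolProperty n m V) ρ ε f →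
          SphereForcing.Monochromatic f) ↔ sInf V = 0) ∧
    (∀ C : Set ℝ, C.Infinite →
      ((∀ f : SphereForcing.E n → C,
        SphereForcing.SatisfiesQStar (SphereForcing.VolProperty n m V) ρ ε f →
          SphereForcing.Monochromatic f) ↔ sInf V = 0)) := by
  have hmono : sInf V = 0 → ∀ C : Set ℝ, ∀ f : SphereForcing.E n → C,
      SphereForcing.SatisfiesQStar (SphereForcing.VolProperty n m V) ρ ε f →
        SphereForcing.Monochromatic f := fun h0 C f hf =>
    SphereForcing.monochromatic_of_small_volumes hm hmn hVpos
      (fun δ hδ => exists_lt_of_csInf_lt hV (h0.trans_lt hδ)) hε hf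
  have hinf : ∀ C : Set ℝ, C.Infinite → (∀ f : SphereForcing.E n → C,
      SphereForcing.SatisfiesQStar (SphereForcing.VolProperty n m V) ρ ε f →
        SphereForcing.Monochromatic f) → sInf V = 0 := by
    intro C hC h
    by_contra h0
    have hpos : 0 < sInf V := (le_csInf hV fun v hv => (hVpos hv).le).lt_of_ne' h0
    have hbdd : BddBelow V := ⟨0, fun v hv => (hVpos hv).le⟩
    have := hC.to_subtype
    obtain ⟨f, hf, hfm⟩ := SphereForcing.exists_not_monochromatic (by omega : m ≠ 0) hmn hpos
      (fun v hv => csInf_le hbdd hv) hρ C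
    exact hfm (h f hf)
  exact ⟨⟨fun h => hinf _ infinite_univ (h _ univ_nonempty), fun h0 C _ => hmono h0 C⟩,
    fun C hC => ⟨hinf C hC, fun h0 => hmono h0 C⟩⟩
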